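/- All graphs are finite, undirected, simple and connected. For a graph $G=(V,E)$, a set $S\subseteq V$ is dominating if every vertex of $V\setminus S$ has at least one neighbour in $S$, and perfect dominating if every vertex of $V\setminus S$ has exactly one neighbour in $S$; $\gamma(G)$ and $\gamma_{11}(G)$ denote the minimum cardinality of a dominating set and of a perfect dominating set of $G$, respectively. A graph is claw-free if it has no induced subgraph isomorphic to $K_{1,3}$. Let $h,k,n$ be integers such that $4\le n\le 7$ and $2\le h\le k\le n$. Then there exists a (connected) claw-free graph $G$ of order $n$ such that $\gamma(G)=h$ and $\gamma_{11}(G)=k$ if and only if $h+k\le n$, or $3h+k+1\le 2n$, or $(h,k,n)=(2,6,6)$. -/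

import Mathlib

namespace SimpleGraph

/-- `S` is a dominating set of `G`: every vertex outside `S` has at least one neighbour in `S`. -/
def IsDominatingSet {V : Type*} (G : SimpleGraph V) (S : Finset V) : Prop :=
  ∀ v, v ∉ S → ∃ u, u ∈ S ∧ G.Adj v u

/-- `S` is a perfect dominating set of `G`: every vertex outside `S` has exactly one
neighbour in `S`. -/
def IsPerfectDominatingSet {V : Type*} (G : SimpleGraph V) (S : Finset V) : Prop :=
  ∀ v, v ∉ S → ∃! u, u ∈ S ∧ G.Adj v u

/-- The domination number of a graph (meant for finite graphs, where the whole vertex set is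
dominating, so that the infimum is a minimum). -/
noncomputable def dominationNumber {V : Type*} (G : SimpleGraph V) : ℕ :=
  sInf {m | ∃ S : Finset V, G.IsDominatingSet S ∧ S.card = m}

/-- The perfect domination number of a graph (meant for finite graphs, where the whole vertex
set is perfect dominating, so that the infimum is a minimum). -/
noncomputable def perfectDominationNumber {V : Type*} (G : SimpleGraph V) : ℕ :=
  sInf {m | ∃ S : Finset V, G.IsPerfectDominatingSet S ∧ S.card = m}

/-- `G` is claw-free: it has no induced subgraph isomorphic to `K_{1,3}`. -/
def IsClawFree {V : Type*} (G : SimpleGraph V) : Prop :=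
  ¬ (completeBipartiteGraph (Fin 1) (Fin 3)).IsIndContained G

end SimpleGraph

/-! By Ore's bound a graph without isolated vertices has `2 * γ ≤ n`
(`two_mul_dominationNumber_le`). For `4 ≤ n ≤ 7` this leaves `γ = 2`, and also `γ = 3` when `n ≥ 6`.
If `γ = 2` and `n ≥ 6`, the numerical condition allows every `k ≤ n`. In the four remaining cases it
says `k ≤ n - γ`, and this bound is verified by exhaustive search in the kernel.

A maximum independent set dominates, so `γ ≥ t` provides `t` independent vertices. They are labelled
first, and the others are sorted by their adjacencies to these (`exists_isPerfectDominatingSet`).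
The search adds vertices one at a time, discarding rows that create a claw, so it meets every such
labelled graph (`leaf_of_search`).

Conversely, 17 triples satisfy the condition, and each has an explicit witness. -/

namespace GraphSearch

/-! ### The search on bit masks. -/

/-- `f x`, written so that kernel reduction evaluates `x` to a literal before it unfolds `f`. -/
def force {α : Type} (x : ℕ) (f : ℕ → α) : α :=
  Nat.rec (motive := fun _ => α) (f 0) (fun y _ => f (Nat.succ y)) x

/-- `List.any` by a bare recursor. -/
def any {α : Type} (l : List α) (p : α → Bool) : Bool :=
  List.rec (motive := fun _ => Bool) false
    (fun a _ ih => Bool.rec (motive := fun _ => Bool) ih true (p a)) l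

/-- `List.all` by a bare recursor. -/
def all {α : Type} (l : List α) (p : α → Bool) : Bool :=
  List.rec (motive := fun _ => Bool) true
    (fun a _ ih => Bool.rec (motive := fun _ => Bool) false ih (p a)) l

def forceList : List ℕ → (List ℕ → Bool) → Bool
  | [], k => k []
  | x :: l, k => force x fun x' => forceList l fun l' => k (x' :: l')

def forcePairs : List (ℕ × ℕ) → (List (ℕ × ℕ) → Bool) → Bool
  | [], k => k []
  | p :: l, k => force p.1 fun a => force p.2 fun b => forcePairs l fun l' => k ((a, b) :: l')

/-- Adds the number `b` to the `i`-th entry of the list for every binary digit `i` of `r`. -/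
def addColumn (b : ℕ) : List ℕ → ℕ → List ℕ
  | [], _ => []
  | x :: l, r => Nat.add x (Nat.mul b (Nat.mod r 2)) :: addColumn b l (Nat.div r 2)

def bit (x i : ℕ) : Bool := Nat.beq (Nat.mod (Nat.shiftRight x i) 2) 1

/-- Patterns `(mask, value)`: a new vertex with row `r` makes a claw when `r &&& mask = value`. -/
def forbidden (N : List ℕ) : List (ℕ × ℕ) :=
  (List.range N.length).flatMap fun x => force x fun x => force (N.getD x 0) fun a =>
    (List.range x).flatMap fun y => force y fun y => bif bit a y then [] else
      force (N.getD y 0) fun b => force (Nat.lor (2 ^ x) (2 ^ y)) fun m =>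
      -- Three pairwise nonadjacent vertices must not all be adjacent to the new vertex, which would
      -- be the centre.
      (((List.range y).filter fun z => !bit (Nat.lor a b) z).map
        fun z => (Nat.lor m (2 ^ z), Nat.lor m (2 ^ z))) ++
      -- At a common neighbour `c` of `x` and `y`, the new vertex must not be a third leaf.
      (((List.range N.length).filter fun c => bit (Nat.land a b) c).map
        fun c => (Nat.lor m (2 ^ c), 2 ^ c))

/-- `x &&& (x - 1)` clears the lowest set bit, so the test accepts zero and the powers of two. A
closed neighbourhood that passes belongs to an isolated vertex. -/
def subsingletonMask (x : ℕ) : Bool := Nat.beq (Nat.land x (Nat.sub x 1)) 0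

/-- Some set of fewer than `t` vertices dominates (for `t = 2`, and for `t = 3` otherwise); `N` lists
the closed neighbourhoods as bit masks and `full` is the mask of all vertices. -/
def dominated (t full : ℕ) (N : List ℕ) : Bool :=
  bif Nat.beq t 2 then any N fun x => Nat.beq x full
  else any N fun x => any N fun y => Nat.beq (Nat.lor x y) full

/-- Every vertex outside the mask `s` has exactly one neighbour in `s`; `b` is the bit of the first
vertex of the list. -/
def perfectMask (s : ℕ) : List ℕ → ℕ → Bool
  | [], _ => true
  | x :: l, b =>
    bif Nat.beq (Nat.land s b) 0 then
      force (Nat.land x s) fun y => bif Nat.beq y 0 then false else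
        bif subsingletonMask y then perfectMask s l (Nat.mul 2 b) else false
    else perfectMask s l (Nat.mul 2 b)

/-- A graph passes if it has an isolated vertex, or fewer than `t` dominating vertices, or one of
the given sets is perfect dominating. -/
def leaf (t full : ℕ) (sets N : List ℕ) : Bool :=
  any N subsingletonMask || (dominated t full N || any sets fun s => perfectMask s N 1)

/-- Extends the graph `N` on `m` vertices by `f` further vertices in all claw-free ways in which the
adjacencies to the first `t` vertices, read as binary numbers, are nondecreasing, and checks that all
resulting graphs pass `leaf`. -/
def search (t full : ℕ) (sets : List ℕ) : ℕ → ℕ → ℕ → List ℕ → Bool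
  | 0, _, _, N => leaf t full sets N
  | f + 1, m, last, N => forcePairs (forbidden N) fun P => force (2 ^ m) fun b =>
      all (List.range b) fun r => force r fun r => force (Nat.mod r (2 ^ t)) fun type =>
        bif Nat.ble last type then bif any P fun p => Nat.beq (Nat.land r p.1) p.2 then true else
          forceList (addColumn b N r ++ [r + b]) fun N' => search t full sets f (m + 1) type N'
        else true

/-- The subsets of `Fin n` with at most `k` elements, as bit masks. -/
def smallSets (n k : ℕ) : List ℕ :=
  (List.range (2 ^ n)).filter fun s =>
    decide ((Finset.univ.filter fun i : Fin n => s.testBit i = true).card ≤ k)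

/-- The search from `t` independent vertices to `n` vertices, for perfect dominating sets of size at
most `k`. -/
def searchAll (t k n : ℕ) : Bool :=
  forceList (smallSets n k) fun sets => force (2 ^ n - 1) fun full =>
    search t full sets (n - t) t 0 ((List.range t).map (2 ^ ·))
end GraphSearch

/-! ### Completeness of the search. -/

namespace GraphSearch

@[simp] theorem force_eq {α : Type} (x : ℕ) (f : ℕ → α) : force x f = f x := by
  cases x <;> rfl

@[simp] theorem any_eq {α : Type} (l : List α) (p : α → Bool) : any l p = l.any p := by
  induction l with
  | nil => rfl
  | cons a l ih => rw [List.any_cons, ← ih]; simp only [any]; cases p a <;> rfl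

@[simp] theorem all_eq {α : Type} (l : List α) (p : α → Bool) : all l p = l.all p := by
  induction l with
  | nil => rfl
  | cons a l ih => rw [List.all_cons, ← ih]; simp only [all]; cases p a <;> rfl

@[simp] theorem forceList_eq (l : List ℕ) (k : List ℕ → Bool) : forceList l k = k l := by
  induction l generalizing k with
  | nil => rfl
  | cons x l ih => simp [forceList, ih]

@[simp] theorem forcePairs_eq (l : List (ℕ × ℕ)) (k : List (ℕ × ℕ) → Bool) :
    forcePairs l k = k l := by
  induction l generalizing k with
  | nil => rfl
  | cons x l ih => simp [forcePairs, ih]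

@[simp] theorem bit_eq (x i : ℕ) : bit x i = x.testBit i := by
  rw [Nat.testBit_eq_decide_div_mod_eq, bit, Bool.eq_iff_iff]
  simp only [Nat.shiftRight_eq, Nat.shiftRight_eq_div_pow, Nat.beq_eq, decide_eq_true_eq]
  rfl

/-- The number whose binary digits are `p 0, …, p (m - 1)`. -/
def code (p : ℕ → Bool) : ℕ → ℕ
  | 0 => 0
  | m + 1 => code p m + 2 ^ m * (p m).toNat

theorem code_lt (p : ℕ → Bool) (m : ℕ) : code p m < 2 ^ m := by
  induction m with
  | zero => simp [code]
  | succ m ih => rw [code, pow_succ]; cases p m <;> simp <;> omega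

theorem testBit_code (p : ℕ → Bool) (m j : ℕ) :
    (code p m).testBit j = (decide (j < m) && p j) := by
  induction m with
  | zero => simp [code]
  | succ m ih =>
    rw [code, Nat.add_comm, Nat.testBit_two_pow_mul_add _ (code_lt p m), ih]
    rcases lt_trichotomy j m with h | rfl | h
    · simp [h, h.trans (Nat.lt_succ_self m)]
    · cases p j <;> simp
    · have h1 : ¬ j < m + 1 := by omega
      have h2 : j - m ≠ 0 := by omega
      simp [h1, h.not_gt, h2, Nat.testBit_bool_toNat]

theorem code_mod (p : ℕ → Bool) {t m : ℕ} (h : t ≤ m) : code p m % 2 ^ t = code p t := by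
  refine Nat.eq_of_testBit_eq fun i => ?_
  rw [Nat.testBit_mod_two_pow, testBit_code, testBit_code]
  by_cases hi : i < t
  · simp [hi, hi.trans_le h]
  · simp [hi]

theorem code_congr {p q : ℕ → Bool} {m : ℕ} (h : ∀ i < m, p i = q i) : code p m = code q m := by
  refine Nat.eq_of_testBit_eq fun i => ?_
  rw [testBit_code, testBit_code]
  by_cases hi : i < m
  · simp [hi, h i hi]
  · simp [hi]

/-- The closed neighbourhood of `i` among the vertices below `m`, as a bit mask. -/
def closedMask (A : ℕ → ℕ → Bool) (m i : ℕ) : ℕ := code (fun j => decide (i = j) || A i j) m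

def masks (A : ℕ → ℕ → Bool) (m : ℕ) : List ℕ := (List.range m).map (closedMask A m)

theorem testBit_closedMask (A : ℕ → ℕ → Bool) (m i j : ℕ) :
    (closedMask A m i).testBit j = (decide (j < m) && (decide (i = j) || A i j)) :=
  testBit_code _ _ _

theorem length_masks (A : ℕ → ℕ → Bool) (m : ℕ) : (masks A m).length = m := by simp [masks]

theorem getD_masks (A : ℕ → ℕ → Bool) {m i : ℕ} (h : i < m) :
    (masks A m).getD i 0 = closedMask A m i := by
  simp [masks, h]

theorem addColumn_eq (b : ℕ) (l : List ℕ) (r : ℕ) :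
    addColumn b l r = l.mapIdx fun i x => x + b * (r / 2 ^ i % 2) := by
  induction l generalizing r with
  | nil => rfl
  | cons x l ih =>
    have h1 : Nat.mod r 2 = r % 2 := rfl
    have h2 (i : ℕ) : Nat.div r 2 / 2 ^ i = r / 2 ^ (i + 1) := by
      rw [pow_succ', ← Nat.div_div_eq_div_mul]; rfl
    simp [addColumn, ih, List.mapIdx_cons, h1, h2]

/-- Masks are truncated to the vertices below `m`, so one more vertex appends a top bit to each old
mask. In the new row the summand `2 ^ m` is the vertex itself. -/
theorem masks_succ {A : ℕ → ℕ → Bool} (hA : ∀ i j, A i j = A j i) (m : ℕ) :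
    addColumn (2 ^ m) (masks A m) (code (A m) m) ++ [code (A m) m + 2 ^ m] = masks A (m + 1) := by
  rw [addColumn_eq]
  apply List.ext_getElem
  · simp [masks]
  intro i h1 h2
  rw [length_masks] at h2
  rcases Nat.lt_succ_iff_lt_or_eq.mp h2 with h | rfl
  · rw [List.getElem_append_left (by simpa [masks] using h)]
    have hb : code (A m) m / 2 ^ i % 2 = (A i m).toNat := by
      rw [← Nat.toNat_testBit, testBit_code, hA m i]; simp [h]
    simp [masks, closedMask, code, hb, h.ne]
  · rw [List.getElem_append_right (by simp [masks])]
    simp only [masks, closedMask, code, List.length_mapIdx, List.length_map, List.length_range,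
      List.getElem_singleton, List.getElem_map, List.getElem_range]
    rw [code_congr (p := A i) (q := fun j => decide (i = j) || A i j)]
    · simp
    · intro j hj
      simp [hj.ne']

/-- No vertex below `n` is the centre of a claw of the adjacency relation `A`. -/
def NoClaw (A : ℕ → ℕ → Bool) (n : ℕ) : Prop :=
  ∀ c < n, ∀ x < n, ∀ y < n, ∀ z < n, A c x → A c y → A c z → x ≠ y → x ≠ z → y ≠ z →
    A x y ∨ A x z ∨ A y z

theorem not_forbidden {A : ℕ → ℕ → Bool} (hA : ∀ i j, A i j = A j i) {n m : ℕ}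
    (hcl : NoClaw A n) (hm : m < n) :
    ∀ p ∈ forbidden (masks A m), code (A m) m &&& p.1 ≠ p.2 := by
  intro p hp he
  simp only [forbidden, List.mem_flatMap, List.mem_range, length_masks, force_eq] at hp
  obtain ⟨x, hx, y, hy, hp⟩ := hp
  have hym := hy.trans hx
  rw [getD_masks A hx, getD_masks A hym] at hp
  cases hxy : A x y with
  | true => simp [testBit_closedMask, hym, hxy] at hp
  | false =>
  have hbit : ∀ j, (code (A m) m &&& p.1).testBit j = p.2.testBit j := fun j => by rw [he]
  simp only [Nat.testBit_and, testBit_code] at hbit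
  simp [testBit_closedMask, hym, hxy, hy.ne', Nat.testBit_or] at hp
  rcases hp with ⟨z, ⟨hz, h1⟩, rfl⟩ | ⟨c, ⟨hc, h1⟩, rfl⟩
  · have hzm := hz.trans hym
    simp only [(hz.trans hy).ne', hz.ne', Nat.testBit_or, Nat.testBit_two_pow] at hbit h1
    have hx' := hbit x
    have hy' := hbit y
    have hz' := hbit z
    simp [hx, hym, hzm] at hx' hy' hz' h1
    have := hcl m hm x (hx.trans hm) y (hym.trans hm) z (hzm.trans hm) hx' hy' hz' hy.ne'
      (hz.trans hy).ne' hz.ne'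
    rcases this with h | h | h <;> simp_all [hzm.not_ge]
  · have hx' := hbit x
    have hy' := hbit y
    have hc' := hbit c
    have hcx : x ≠ c := by
      rintro rfl
      simp [hxy, hA y x] at h1
      exact hy.ne h1.2
    have hcy : y ≠ c := by
      rintro rfl
      simp [hxy] at h1
      exact hy.ne' h1.1.2
    simp [hx, hym, hc, Nat.testBit_or, Nat.testBit_two_pow, hcx.symm, hcy.symm, hy.ne, hy.ne']
      at hx' hy' hc'
    simp [hc, hcx, hcy] at h1
    have := hcl c (hc.trans hm) m hm x (hx.trans hm) y (hym.trans hm) (by rwa [hA])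
      (by rw [hA]; exact h1.1) (by rw [hA]; exact h1.2) hx.ne' hym.ne' hy.ne'
    simp_all

/-- Choosing the true row `code (A m) m` at each stage follows a branch that is never cut:
sortedness passes the test on `last`, and `not_forbidden` the claw test. This branch ends at the
graph itself. -/
theorem leaf_of_search {A : ℕ → ℕ → Bool} (hA : ∀ i j, A i j = A j i) {n t full : ℕ}
    {sets : List ℕ} (hcl : NoClaw A n)
    (hsort : ∀ i j, t ≤ i → i ≤ j → j < n → code (A i) t ≤ code (A j) t) (f : ℕ) :
    ∀ m last, t ≤ m → f + m = n → (∀ i, m ≤ i → i < n → last ≤ code (A i) t) →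
      search t full sets f m last (masks A m) = true → leaf t full sets (masks A n) = true := by
  induction f with
  | zero =>
    intro m last _ hm _ h
    obtain rfl : m = n := by omega
    exact h
  | succ f ih =>
    intro m last htm hm hlast h
    simp only [search, forcePairs_eq, force_eq, all_eq, any_eq, forceList_eq,
      List.all_eq_true, List.mem_range] at h
    have h := h (code (A m) m) (code_lt _ _)
    rw [masks_succ hA] at h
    have h1 : Nat.mod (code (A m) m) (2 ^ t) = code (A m) t := code_mod _ htm
    rw [h1, Nat.ble_eq_true_of_le (hlast m le_rfl (by omega))] at h
    have h2 : ((forbidden (masks A m)).any fun p =>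
        Nat.beq (Nat.land (code (A m) m) p.1) p.2) = false := by
      rw [List.any_eq_false]
      intro p hp hb
      exact not_forbidden hA hcl (by omega) p hp (Nat.eq_of_beq_eq_true hb)
    rw [h2] at h
    exact ih (m + 1) _ (by omega) (by omega)
      (fun i hi hin => hsort m i htm (by omega) hin) h

end GraphSearch

/-! ### Claws, relabelling and Ore's bound. -/

namespace SimpleGraph

theorem isClawFree_iff {V : Type*} {G : SimpleGraph V} : G.IsClawFree ↔
    ∀ c x, G.Adj c x → ∀ y, G.Adj c y → ∀ z, G.Adj c z → x ≠ y → x ≠ z → y ≠ z →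
      G.Adj x y ∨ G.Adj x z ∨ G.Adj y z := by
  constructor
  · intro h c x hx y hy z hz hxy hxz hyz
    by_contra! hn
    obtain ⟨h1, h2, h3⟩ := hn
    refine h ⟨⟨⟨Sum.elim (fun _ => c) ![x, y, z], ?_⟩, ?_⟩⟩
    · rintro (a | a) (b | b) hab
      · exact congrArg _ (Subsingleton.elim a b)
      · fin_cases b <;> simp_all
      · fin_cases a <;> simp_all
      · fin_cases a <;> fin_cases b <;> simp_all
    · intro a b
      change G.Adj (Sum.elim (fun _ => c) ![x, y, z] a) (Sum.elim (fun _ => c) ![x, y, z] b) ↔ _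
      rcases a with a | a <;> rcases b with b | b
      · simp
      · fin_cases b <;> simp [hx, hy, hz]
      · fin_cases a <;> simp [hx.symm, hy.symm, hz.symm]
      · fin_cases a <;> fin_cases b <;> simp [h1, h2, h3, G.adj_comm y x, G.adj_comm z x,
          G.adj_comm z y]
  · rintro h ⟨f⟩
    have hc (i : Fin 3) : G.Adj (f (.inl 0)) (f (.inr i)) := f.map_rel_iff.mpr (by simp)
    have hl (i j : Fin 3) : ¬ G.Adj (f (.inr i)) (f (.inr j)) := fun hij => by
      simpa using f.map_rel_iff.mp hij
    have hne {i j : Fin 3} (hij : i ≠ j) : f (.inr i) ≠ f (.inr j) := fun he =>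
      hij (Sum.inr_injective (f.injective he))
    rcases h _ _ (hc 0) _ (hc 1) _ (hc 2) (hne (by decide)) (hne (by decide)) (hne (by decide))
      with h | h | h <;> exact hl _ _ h

theorem IsClawFree.comap {V W : Type*} {G : SimpleGraph V} (h : G.IsClawFree) (e : W ≃ V) :
    (G.comap e).IsClawFree := by
  rw [isClawFree_iff] at h ⊢
  intro c x hx y hy z hz hxy hxz hyz
  exact h _ _ hx _ hy _ hz (e.injective.ne hxy) (e.injective.ne hxz) (e.injective.ne hyz)

theorem IsDominatingSet.map_of_comap {V W : Type*} {G : SimpleGraph V} (e : W ≃ V) {S : Finset W}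
    (h : (G.comap e).IsDominatingSet S) : G.IsDominatingSet (S.map e.toEmbedding) := by
  intro v hv
  obtain ⟨w, rfl⟩ := e.surjective v
  obtain ⟨u, hu, ha⟩ := h w (by simpa using hv)
  exact ⟨e u, by simpa using hu, ha⟩

theorem IsPerfectDominatingSet.map_of_comap {V W : Type*} {G : SimpleGraph V} (e : W ≃ V)
    {S : Finset W} (h : (G.comap e).IsPerfectDominatingSet S) :
    G.IsPerfectDominatingSet (S.map e.toEmbedding) := by
  intro v hv
  obtain ⟨w, rfl⟩ := e.surjective v
  obtain ⟨u, ⟨hu, ha⟩, hun⟩ := h w (by simpa using hv)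
  refine ⟨e u, ⟨by simpa using hu, ha⟩, fun x hx => ?_⟩
  obtain ⟨y, rfl⟩ := e.surjective x
  rw [hun y ⟨by simpa using hx.1, hx.2⟩]

/-- An undominated vertex could be added to an independent set of maximum size. -/
theorem exists_isIndepSet_isDominatingSet {V : Type*} [Fintype V] (G : SimpleGraph V) :
    ∃ I : Finset V, G.IsIndepSet I ∧ G.IsDominatingSet I := by
  classical
  obtain ⟨I, hI, hmax⟩ := Finset.exists_max_image
    ((Finset.univ : Finset (Finset V)).filter fun I : Finset V => G.IsIndepSet (I : Set V))
    Finset.card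
    ⟨∅, by simp [IsIndepSet]⟩
  simp only [Finset.mem_filter, Finset.mem_univ, true_and] at hI hmax
  refine ⟨I, hI, fun v hv => ?_⟩
  by_contra! hn
  have := hmax (insert v I) (by
    rw [Finset.coe_insert, IsIndepSet, Set.pairwise_insert]
    exact ⟨hI, fun u hu _ => ⟨hn u hu, fun h => hn u hu h.symm⟩⟩)
  rw [Finset.card_insert_of_notMem hv] at this
  omega

theorem dominationNumber_le {V : Type*} {G : SimpleGraph V} {S : Finset V}
    (h : G.IsDominatingSet S) : G.dominationNumber ≤ S.card := Nat.sInf_le ⟨S, h, rfl⟩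

theorem perfectDominationNumber_le {V : Type*} {G : SimpleGraph V} {S : Finset V}
    (h : G.IsPerfectDominatingSet S) : G.perfectDominationNumber ≤ S.card := Nat.sInf_le ⟨S, h, rfl⟩

theorem exists_isDominatingSet_card_eq {V : Type*} [Fintype V] (G : SimpleGraph V) :
    ∃ S : Finset V, G.IsDominatingSet S ∧ S.card = G.dominationNumber :=
  Nat.sInf_mem (s := {m | ∃ S : Finset V, G.IsDominatingSet S ∧ S.card = m})
    ⟨_, Finset.univ, fun v hv => absurd (Finset.mem_univ v) hv, rfl⟩

/-- Ore's bound. -/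
theorem two_mul_dominationNumber_le {V : Type*} [Fintype V] {G : SimpleGraph V}
    (hG : ∀ v, ∃ u, G.Adj v u) : 2 * G.dominationNumber ≤ Fintype.card V := by
  classical
  obtain ⟨S, hS, hc⟩ := G.exists_isDominatingSet_card_eq
  -- If `v ∈ S` had no neighbour outside `S`, then `S.erase v` would still dominate, contradicting
  -- minimality.
  have hcompl : G.IsDominatingSet Sᶜ := by
    intro v hv
    rw [Finset.mem_compl, not_not] at hv
    by_contra! hn
    simp only [Finset.mem_compl] at hn
    have hdom : G.IsDominatingSet (S.erase v) := by
      intro w hw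
      by_cases hwv : w = v
      · obtain ⟨u, hu⟩ := hG v
        subst hwv
        exact ⟨u, Finset.mem_erase.mpr ⟨hu.ne', by_contra fun h => hn u h hu⟩, hu⟩
      · have hwS : w ∉ S := fun h => hw (Finset.mem_erase.mpr ⟨hwv, h⟩)
        obtain ⟨u, hu, ha⟩ := hS w hwS
        refine ⟨u, Finset.mem_erase.mpr ⟨?_, hu⟩, ha⟩
        rintro rfl
        exact hn w hwS ha.symm
    have := dominationNumber_le hdom
    have := Finset.card_erase_lt_of_mem hv
    omega
  have := dominationNumber_le hcompl
  rw [Finset.card_compl] at this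
  have := Finset.card_le_univ S
  omega

end SimpleGraph

/-! ### From the search to arbitrary claw-free graphs. -/

namespace GraphSearch
open SimpleGraph

theorem isPowerOfTwo_of_subsingletonMask {x : ℕ} (hx : x ≠ 0) (h : subsingletonMask x = true) :
    ∃ k, x = 2 ^ k :=
  (Nat.and_sub_one_eq_zero_iff_isPowerOfTwo hx).mp (Nat.eq_of_beq_eq_true h)

theorem of_perfectMask {s : ℕ} (l : List ℕ) (i : ℕ) (h : perfectMask s l (2 ^ i) = true) :
    ∀ j (hj : j < l.length), s.testBit (i + j) = true ∨ ∃ k, l[j] &&& s = 2 ^ k := by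
  induction l generalizing i with
  | nil => simp
  | cons x l ih =>
    have hb : Nat.mul 2 (2 ^ i) = 2 ^ (i + 1) := by rw [pow_succ']; rfl
    have hs : Nat.land s (2 ^ i) = (s.testBit i).toNat * 2 ^ i := Nat.and_two_pow s i
    have hx : Nat.land x s = x &&& s := rfl
    rw [perfectMask, hb, force_eq, hs, hx] at h
    have h2 : perfectMask s l (2 ^ (i + 1)) = true := by
      revert h
      cases s.testBit i <;> cases Nat.beq (x &&& s) 0 <;>
        cases subsingletonMask (x &&& s) <;> simp
    rintro (_ | j) hj
    · cases hi : s.testBit i with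
      | true => exact Or.inl rfl
      | false =>
        right
        rw [hi] at h
        cases h0 : Nat.beq (x &&& s) 0 with
        | true => simp [h0] at h
        | false =>
          cases h1 : subsingletonMask (x &&& s) with
          | false => simp [h0, h1] at h
          | true => exact isPowerOfTwo_of_subsingletonMask (Nat.ne_of_beq_eq_false h0) h1
    · have := ih (i + 1) h2 j (by simpa using hj)
      rwa [add_assoc, add_comm 1 j] at this

/-- Adjacency of a graph on `Fin n`, extended to all natural numbers. -/
noncomputable def adjNat {n : ℕ} (G : SimpleGraph (Fin n)) (i j : ℕ) : Bool :=
  open Classical in decide (∃ (hi : i < n) (hj : j < n), G.Adj ⟨i, hi⟩ ⟨j, hj⟩)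

theorem adjNat_eq_true {n : ℕ} {G : SimpleGraph (Fin n)} {i j : ℕ} :
    adjNat G i j = true ↔ ∃ (hi : i < n) (hj : j < n), G.Adj ⟨i, hi⟩ ⟨j, hj⟩ := by
  simp [adjNat]

@[simp] theorem adjNat_val {n : ℕ} {G : SimpleGraph (Fin n)} {i j : Fin n} :
    adjNat G i j = true ↔ G.Adj i j := by
  simp [adjNat]

theorem adjNat_comm {n : ℕ} (G : SimpleGraph (Fin n)) (i j : ℕ) :
    adjNat G i j = adjNat G j i := by
  rw [Bool.eq_iff_iff, adjNat_eq_true, adjNat_eq_true]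
  exact ⟨fun ⟨a, b, h⟩ => ⟨b, a, h.symm⟩, fun ⟨a, b, h⟩ => ⟨b, a, h.symm⟩⟩

theorem noClaw_adjNat {n : ℕ} {G : SimpleGraph (Fin n)} (h : G.IsClawFree) :
    NoClaw (adjNat G) n := by
  rw [isClawFree_iff] at h
  intro c hc x hx y hy z hz hcx hcy hcz hxy hxz hyz
  lift c to Fin n using hc
  lift x to Fin n using hx
  lift y to Fin n using hy
  lift z to Fin n using hz
  simp only [adjNat_val] at *
  exact h c x hcx y hcy z hcz (by simpa [Fin.ext_iff] using hxy) (by simpa [Fin.ext_iff] using hxz)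
    (by simpa [Fin.ext_iff] using hyz)

theorem testBit_closedMask_adjNat {n : ℕ} (G : SimpleGraph (Fin n)) (i j : Fin n) :
    (closedMask (adjNat G) n i).testBit j = true ↔ i = j ∨ G.Adj i j := by
  rw [testBit_closedMask]
  simp [Fin.ext_iff]

theorem exists_of_leaf {n t k : ℕ} {G : SimpleGraph (Fin n)} (ht : t = 2 ∨ 3 ≤ t)
    (hG : ∀ v, ∃ u, G.Adj v u) (hdom : ∀ S, G.IsDominatingSet S → t ≤ S.card)
    (h : leaf t (2 ^ n - 1) (smallSets n k) (masks (adjNat G) n) = true) :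
    ∃ S, G.IsPerfectDominatingSet S ∧ S.card ≤ k := by
  have hmem {x : ℕ} (hx : x ∈ masks (adjNat G) n) :
      ∃ i : Fin n, x = closedMask (adjNat G) n i := by
    simp only [masks, List.mem_map, List.mem_range] at hx
    obtain ⟨i, hi, rfl⟩ := hx
    exact ⟨⟨i, hi⟩, rfl⟩
  simp only [leaf, any_eq, Bool.or_eq_true] at h
  rcases h with h | h | h
  · exfalso
    obtain ⟨x, hx, h⟩ := List.any_eq_true.mp h
    obtain ⟨i, rfl⟩ := hmem hx
    obtain ⟨u, hu⟩ := hG i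
    have h1 := (testBit_closedMask_adjNat G i i).mpr (Or.inl rfl)
    have h2 := (testBit_closedMask_adjNat G i u).mpr (Or.inr hu)
    obtain ⟨k, hk⟩ := isPowerOfTwo_of_subsingletonMask (fun h0 => by simp [h0] at h1) h
    simp only [hk, Nat.testBit_two_pow, decide_eq_true_eq] at h1 h2
    exact hu.ne (Fin.ext (h1.symm.trans h2))
  · exfalso
    rw [dominated] at h
    cases ht2 : Nat.beq t 2 with
    | true =>
      simp only [ht2, cond_true, any_eq, List.any_eq_true] at h
      obtain ⟨x, hx, h⟩ := h
      obtain ⟨i, rfl⟩ := hmem hx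
      have h := Nat.eq_of_beq_eq_true h
      have := hdom {i} fun v hv => by
        refine ⟨i, by simp, ?_⟩
        have h1 := testBit_closedMask_adjNat G i v
        rw [h, Nat.testBit_two_pow_sub_one] at h1
        have h2 := h1.mp (by simp)
        rw [Finset.mem_singleton] at hv
        exact (h2.resolve_left (Ne.symm hv)).symm
      rw [Finset.card_singleton] at this
      have := Nat.eq_of_beq_eq_true ht2
      omega
    | false =>
      have ht2 := Nat.ne_of_beq_eq_false ht2
      simp only [cond_false, any_eq, List.any_eq_true, *] at h
      obtain ⟨x, hx, y, hy, h⟩ := h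
      obtain ⟨i, rfl⟩ := hmem hx
      obtain ⟨j, rfl⟩ := hmem hy
      have h : closedMask (adjNat G) n i ||| closedMask (adjNat G) n j = 2 ^ n - 1 :=
        Nat.eq_of_beq_eq_true h
      have := hdom {i, j} fun v hv => by
        have h1 := congrArg (fun x => x.testBit v) h
        simp only [Nat.testBit_or, Nat.testBit_two_pow_sub_one, v.2, decide_true,
          Bool.or_eq_true, testBit_closedMask_adjNat] at h1
        simp only [Finset.mem_insert, Finset.mem_singleton, not_or] at hv
        rcases h1 with (h1 | h1) | h1 | h1
        · exact absurd h1.symm hv.1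
        · exact ⟨i, by simp, h1.symm⟩
        · exact absurd h1.symm hv.2
        · exact ⟨j, by simp, h1.symm⟩
      have := Finset.card_le_two (a := i) (b := j)
      omega
  · obtain ⟨s, hs, h⟩ := List.any_eq_true.mp h
    simp only [smallSets, List.mem_filter, decide_eq_true_eq] at hs
    refine ⟨_, fun v hv => ?_, hs.2⟩
    rw [Finset.mem_filter, not_and] at hv
    have hv := hv (Finset.mem_univ v)
    have h1 := of_perfectMask (masks (adjNat G) n) 0 h v (by simp [length_masks])
    rw [Nat.zero_add] at h1
    obtain ⟨u, hu⟩ := h1.resolve_left hv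
    -- As `v` lies outside the set, its open and closed neighbourhoods meet the set in the same
    -- vertices.
    have huw (w : Fin n) : (s.testBit w = true ∧ G.Adj v w) ↔ u = w := by
      have h2 := congrArg (fun x => x.testBit w) hu
      simp only [masks, List.getElem_map, List.getElem_range, Nat.testBit_and,
        Nat.testBit_two_pow] at h2
      rw [Bool.eq_iff_iff, Bool.and_eq_true, testBit_closedMask_adjNat, decide_eq_true_eq] at h2
      rw [← h2]
      constructor
      · exact fun h => ⟨Or.inr h.2, h.1⟩
      · rintro ⟨rfl | h3, h4⟩
        · exact absurd h4 hv
        · exact ⟨h4, h3⟩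
    have hex : ∃ w : Fin n, u = w := by
      have hun : u < n := by
        by_contra hn
        have h2 := congrArg (fun x => x.testBit u) hu
        simp [masks, testBit_closedMask, hn] at h2
      exact ⟨⟨u, hun⟩, rfl⟩
    obtain ⟨w, hw⟩ := hex
    refine ⟨w, by simpa using (huw w).mpr hw, fun x hx => ?_⟩
    exact Fin.ext (((huw x).mp (by simpa using hx)).symm.trans hw)

theorem exists_of_sorted {n t k : ℕ} {G : SimpleGraph (Fin n)} (ht : t = 2 ∨ 3 ≤ t) (htn : t ≤ n)
    (hs : searchAll t k n = true) (hcl : G.IsClawFree)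
    (hG : ∀ v, ∃ u, G.Adj v u) (hdom : ∀ S, G.IsDominatingSet S → t ≤ S.card)
    (hindep : ∀ i < t, ∀ j < t, adjNat G i j = false)
    (hsort : ∀ i j, t ≤ i → i ≤ j → j < n → code (adjNat G i) t ≤ code (adjNat G j) t) :
    ∃ S, G.IsPerfectDominatingSet S ∧ S.card ≤ k := by
  refine exists_of_leaf ht hG hdom ?_
  have h0 : (List.range t).map (2 ^ ·) = masks (adjNat G) t := by
    refine List.map_congr_left fun i hi => Nat.eq_of_testBit_eq fun j => ?_
    rw [List.mem_range] at hi
    rw [testBit_closedMask, Nat.testBit_two_pow]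
    by_cases hj : j < t
    · simp [hj, hindep i hi j hj]
    · have : i ≠ j := by omega
      simp [hj, this]
  rw [searchAll, forceList_eq, force_eq, h0] at hs
  exact leaf_of_search (adjNat_comm G) (noClaw_adjNat hcl) hsort _ _ _ le_rfl (by omega)
    (fun _ _ _ => Nat.zero_le _) hs

/-- A labelling that puts the prescribed vertices first and sorts the others by a given key. -/
theorem exists_perm_sorted {n t : ℕ} (key : Fin n → ℕ) (hlt : ∀ i : Fin n, i < t → key i = i)
    (hge : ∀ i : Fin n, t ≤ i → t ≤ key i) :
    ∃ τ : Equiv.Perm (Fin n), (∀ i : Fin n, i < t → τ i = i) ∧ Monotone (key ∘ τ) := by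
  refine ⟨Tuple.sort key, ?_, Tuple.monotone_sort key⟩
  set τ := Tuple.sort key
  have hmono : Monotone (key ∘ τ) := Tuple.monotone_sort key
  intro i
  induction i using WellFoundedLT.induction with
  | _ i ih =>
  intro hi
  obtain ⟨p, hp⟩ := τ.surjective i
  -- Indices below `i` are already fixed, so the preimage of `i` cannot be smaller; monotonicity
  -- then bounds `key (τ i)` by `i`.
  have hip : i ≤ p := by
    by_contra! hpi
    have := ih p hpi (lt_trans hpi hi)
    exact hpi.ne (this.symm.trans hp)
  have h1 : key (τ i) ≤ i := by
    have := hmono hip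
    rwa [Function.comp_apply, Function.comp_apply, hp, hlt i hi] at this
  have h2 : (τ i : ℕ) < t := by
    by_contra! h
    have := hge _ h
    omega
  rw [hlt _ h2] at h1
  rcases (show τ i ≤ i from h1).lt_or_eq with h | h
  · exact absurd (τ.injective (ih _ h h2)) h.ne
  · exact h

theorem exists_isPerfectDominatingSet {n t k : ℕ} (G : SimpleGraph (Fin n)) (ht : t = 2 ∨ 3 ≤ t)
    (hs : searchAll t k n = true) (hcl : G.IsClawFree)
    (hG : ∀ v, ∃ u, G.Adj v u) (hdom : ∀ S, G.IsDominatingSet S → t ≤ S.card) :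
    ∃ S, G.IsPerfectDominatingSet S ∧ S.card ≤ k := by
  obtain ⟨I, hI, hId⟩ := G.exists_isIndepSet_isDominatingSet
  have htI := hdom I hId
  have htn : t ≤ n := htI.trans (by simpa using I.card_le_univ)
  let x := I.orderEmbOfCardLe htI
  -- Extends the embedding of the first `t` labels into `I` to a bijection of all labels.
  obtain ⟨g, hg⟩ := Finset.exists_equiv_extend_of_card_eq (t := Finset.univ) (by simp)
    (s := Finset.univ.filter fun i : Fin n => (i : ℕ) < t)
    (f := fun i : Fin n => if h : (i : ℕ) < t then x ⟨i, h⟩ else i) (by simp) (by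
      intro i hi j hj hij
      simp only [Finset.coe_filter, Finset.mem_univ, true_and, Set.mem_ofPred_eq] at hi hj
      simp only [hi, hj, dite_true, x.injective.eq_iff, Fin.mk.injEq] at hij
      exact Fin.ext hij)
  let σ : Fin n ≃ Fin n := g.trans (Equiv.subtypeUnivEquiv Finset.mem_univ)
  have hσ (i : Fin n) (hi : (i : ℕ) < t) : σ i ∈ I := by
    have := hg i (by simpa using hi)
    rw [dif_pos hi] at this
    change (g i : Fin n) ∈ I
    rw [this]
    exact Finset.orderEmbOfCardLe_mem _ _ _
  let H := G.comap σ
  -- The offset `t` keeps the independent vertices in front when sorting.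
  let key : Fin n → ℕ := fun i => if (i : ℕ) < t then i else t + code (adjNat H i) t
  obtain ⟨τ, hτ, hmono⟩ := exists_perm_sorted (t := t) key (fun i hi => if_pos hi)
    (fun i hi => by simp [key, hi.not_gt])
  have hτ' (i : Fin n) (hi : t ≤ (i : ℕ)) : t ≤ (τ i : ℕ) := by
    by_contra! h
    have := τ.injective (hτ _ h)
    rw [this] at h
    omega
  let e : Fin n ≃ Fin n := τ.trans σ
  -- Since `τ` fixes the first `t` labels, it permutes the codes without changing them.
  have hcode (i : Fin n) : code (adjNat (G.comap e) i) t = code (adjNat H (τ i)) t := by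
    refine code_congr fun j hj => ?_
    have hj' : (⟨j, hj.trans_le htn⟩ : Fin n).val < t := hj
    have h1 := hτ _ hj'
    change adjNat (G.comap e) i (⟨j, hj.trans_le htn⟩ : Fin n).val =
      adjNat H (τ i) (⟨j, hj.trans_le htn⟩ : Fin n).val
    rw [Bool.eq_iff_iff, adjNat_val, adjNat_val]
    change G.Adj (σ (τ i)) (σ (τ ⟨j, _⟩)) ↔ G.Adj (σ (τ i)) (σ ⟨j, _⟩)
    rw [h1]
  obtain ⟨S, hS, hc⟩ := exists_of_sorted (G := G.comap e) ht htn hs (hcl.comap e)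
    (fun v => by
      obtain ⟨u, hu⟩ := hG (e v)
      exact ⟨e.symm u, by simpa using hu⟩)
    (fun S hS => by simpa using hdom _ hS.map_of_comap)
    (fun i hi j hj => by
      rw [Bool.eq_false_iff, Ne, adjNat_eq_true]
      rintro ⟨hi', hj', h⟩
      change G.Adj (σ (τ _)) (σ (τ _)) at h
      rw [hτ _ hi, hτ _ hj] at h
      exact hI (hσ _ hi) (hσ _ hj) h.ne h)
    (fun i j hti hij hj => by
      have h1 := hmono (show (⟨i, hij.trans_lt hj⟩ : Fin n) ≤ ⟨j, hj⟩ from hij)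
      have h2 := hτ' ⟨i, hij.trans_lt hj⟩ hti
      have h3 := hτ' ⟨j, hj⟩ (hti.trans hij)
      simp only [Function.comp_apply, key, h2.not_gt, h3.not_gt, if_false, ← hcode] at h1
      exact Nat.le_of_add_le_add_left h1)
  exact ⟨_, hS.map_of_comap, by simpa using hc⟩

end GraphSearch

/-! ### The four searches and the witnesses. -/

namespace GraphSearch
open SimpleGraph

/-- In this and the next three searches, the arguments are a lower bound `t` for `γ`, the largest
`k` allowed when `γ = t`, and `n`. -/
theorem searchAll_four : searchAll 2 2 4 = true := by decide +kernel

theorem searchAll_five : searchAll 2 3 5 = true := by decide +kernel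

theorem searchAll_six : searchAll 3 3 6 = true := by decide +kernel

theorem searchAll_seven : searchAll 3 4 7 = true := by decide +kernel

def graphOfEdges (n : ℕ) (l : List (ℕ × ℕ)) : SimpleGraph (Fin n) :=
  SimpleGraph.fromRel fun i j => ((i : ℕ), (j : ℕ)) ∈ l

instance (n : ℕ) (l : List (ℕ × ℕ)) : DecidableRel (graphOfEdges n l).Adj := by
  unfold graphOfEdges; infer_instance

/-- Descending through smaller neighbours ends at `0`. This replaces connectedness by a condition
that is cheap to decide. -/
theorem connected_of_exists_lt {n : ℕ} [NeZero n] {G : SimpleGraph (Fin n)}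
    (h : ∀ v, v ≠ 0 → ∃ u < v, G.Adj v u) : G.Connected := by
  have h0 (v : Fin n) : G.Reachable v 0 := by
    induction v using WellFoundedLT.induction with
    | _ v ih =>
    by_cases hv : v = 0
    · rw [hv]
    · obtain ⟨u, hu, ha⟩ := h v hv
      exact ha.reachable.trans (ih u hu)
  exact ⟨fun u v => (h0 u).trans (h0 v).symm⟩

theorem sInf_card_eq {V : Type*} {P : Finset V → Prop} {m : ℕ} (h1 : ∃ S, P S ∧ S.card = m)
    (h2 : ∀ S, P S → m ≤ S.card) : sInf {m | ∃ S : Finset V, P S ∧ S.card = m} = m := by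
  refine le_antisymm (Nat.sInf_le h1) (le_csInf ⟨m, h1⟩ ?_)
  rintro _ ⟨S, hS, rfl⟩
  exact h2 S hS

/-- `G` is connected and claw-free with domination number `h` and perfect domination number `k`,
expressed so that it can be decided. -/
def Realizes {n : ℕ} [NeZero n] (G : SimpleGraph (Fin n)) (h k : ℕ) : Prop :=
  (∀ v, v ≠ 0 → ∃ u < v, G.Adj v u) ∧
  (∀ c x, G.Adj c x → ∀ y, G.Adj c y → ∀ z, G.Adj c z →
    x = y ∨ x = z ∨ y = z ∨ G.Adj x y ∨ G.Adj x z ∨ G.Adj y z) ∧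
  (∃ S : Finset (Fin n), (∀ v, v ∉ S → ∃ u, u ∈ S ∧ G.Adj v u) ∧ S.card = h) ∧
  (∀ S : Finset (Fin n), (∀ v, v ∉ S → ∃ u, u ∈ S ∧ G.Adj v u) → h ≤ S.card) ∧
  (∃ S : Finset (Fin n), (∀ v, v ∉ S → ∃ u, (u ∈ S ∧ G.Adj v u) ∧
    ∀ w, w ∈ S ∧ G.Adj v w → w = u) ∧ S.card = k) ∧
  (∀ S : Finset (Fin n), (∀ v, v ∉ S → ∃ u, (u ∈ S ∧ G.Adj v u) ∧
    ∀ w, w ∈ S ∧ G.Adj v w → w = u) → k ≤ S.card)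

set_option synthInstance.maxSize 2000 in
set_option synthInstance.maxHeartbeats 400000 in
instance {n : ℕ} [NeZero n] (G : SimpleGraph (Fin n)) [DecidableRel G.Adj] (h k : ℕ) :
    Decidable (Realizes G h k) := by
  unfold Realizes; infer_instance

theorem Realizes.exists_graph {n h k : ℕ} [NeZero n] {G : SimpleGraph (Fin n)}
    (H : Realizes G h k) :
    ∃ G : SimpleGraph (Fin n), G.Connected ∧ G.IsClawFree ∧
      G.dominationNumber = h ∧ G.perfectDominationNumber = k := by
  obtain ⟨h1, h2, h3, h4, h5, h6⟩ := H
  have hcl : G.IsClawFree := isClawFree_iff.mpr fun c x hx y hy z hz hxy hxz hyz => by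
    simpa [hxy, hxz, hyz] using h2 c x hx y hy z hz
  exact ⟨G, connected_of_exists_lt h1, hcl, sInf_card_eq h3 h4,
    sInf_card_eq h5 h6⟩

theorem exists_dominationNumbers_eq {n h k : ℕ} (hn4 : 4 ≤ n) (hn7 : n ≤ 7) (hh : 2 ≤ h)
    (hhk : h ≤ k) (hkn : k ≤ n)
    (H : h + k ≤ n ∨ 3 * h + k + 1 ≤ 2 * n ∨ (h = 2 ∧ k = 6 ∧ n = 6)) :
    ∃ G : SimpleGraph (Fin n), G.Connected ∧ G.IsClawFree ∧
      G.dominationNumber = h ∧ G.perfectDominationNumber = k := by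
  have hcases : (n = 4 ∧ h = 2 ∧ k = 2) ∨
      (n = 5 ∧ h = 2 ∧ k = 2) ∨
      (n = 5 ∧ h = 2 ∧ k = 3) ∨
      (n = 6 ∧ h = 2 ∧ k = 2) ∨
      (n = 6 ∧ h = 2 ∧ k = 3) ∨
      (n = 6 ∧ h = 2 ∧ k = 4) ∨
      (n = 6 ∧ h = 2 ∧ k = 5) ∨
      (n = 6 ∧ h = 2 ∧ k = 6) ∨
      (n = 6 ∧ h = 3 ∧ k = 3) ∨
      (n = 7 ∧ h = 2 ∧ k = 2) ∨
      (n = 7 ∧ h = 2 ∧ k = 3) ∨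
      (n = 7 ∧ h = 2 ∧ k = 4) ∨
      (n = 7 ∧ h = 2 ∧ k = 5) ∨
      (n = 7 ∧ h = 2 ∧ k = 6) ∨
      (n = 7 ∧ h = 2 ∧ k = 7) ∨
      (n = 7 ∧ h = 3 ∧ k = 3) ∨
      (n = 7 ∧ h = 3 ∧ k = 4) := by
    have h7 : h ≤ 7 := by omega
    interval_cases n <;> interval_cases h <;> interval_cases k <;> revert H <;> decide
  rcases hcases with ⟨rfl, rfl, rfl⟩ |
    ⟨rfl, rfl, rfl⟩ |
    ⟨rfl, rfl, rfl⟩ |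
    ⟨rfl, rfl, rfl⟩ |
    ⟨rfl, rfl, rfl⟩ |
    ⟨rfl, rfl, rfl⟩ |
    ⟨rfl, rfl, rfl⟩ |
    ⟨rfl, rfl, rfl⟩ |
    ⟨rfl, rfl, rfl⟩ |
    ⟨rfl, rfl, rfl⟩ |
    ⟨rfl, rfl, rfl⟩ |
    ⟨rfl, rfl, rfl⟩ |
    ⟨rfl, rfl, rfl⟩ |
    ⟨rfl, rfl, rfl⟩ |
    ⟨rfl, rfl, rfl⟩ |
    ⟨rfl, rfl, rfl⟩ |
    ⟨rfl, rfl, rfl⟩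
  · exact Realizes.exists_graph (G := graphOfEdges _ [(0, 1), (0, 2), (1, 3)])
      (by decide +kernel)
  · exact Realizes.exists_graph (G := graphOfEdges _ [(0, 1), (0, 2), (1, 3), (3, 4)])
      (by decide +kernel)
  · exact Realizes.exists_graph (G := graphOfEdges _ [(0, 1), (0, 2), (0, 3), (1, 2), (1, 4)])
      (by decide +kernel)
  · exact Realizes.exists_graph (G := graphOfEdges _ [(0, 1), (0, 2), (1, 3), (3, 4), (4, 5)])
      (by decide +kernel)
  · exact Realizes.exists_graph (G := graphOfEdges _
      [(0, 1), (0, 2), (0, 3), (1, 2), (1, 4), (1, 5), (4, 5)])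
      (by decide +kernel)
  · exact Realizes.exists_graph (G := graphOfEdges _
      [(0, 1), (0, 2), (0, 3), (0, 4), (1, 2), (1, 3), (1, 5), (2, 3)])
      (by decide +kernel)
  · exact Realizes.exists_graph (G := graphOfEdges _
      [(0, 1), (0, 2), (0, 3), (0, 4), (1, 2), (1, 3), (1, 5), (2, 3), (2, 5)])
      (by decide +kernel)
  -- The exceptional triple is realized by the 3-sun: a triangle with a further triangle on each
  -- side.
  · exact Realizes.exists_graph (G := graphOfEdges _
      [(0, 1), (0, 2), (0, 3), (0, 4), (1, 2), (1, 4), (1, 5), (2, 3), (2, 5)])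
      (by decide +kernel)
  -- The net: a triangle with a pendant vertex at each corner.
  · exact Realizes.exists_graph (G := graphOfEdges _
      [(0, 1), (0, 2), (0, 3), (1, 2), (1, 4), (2, 5)])
      (by decide +kernel)
  · exact Realizes.exists_graph (G := graphOfEdges _
      [(0, 1), (0, 2), (0, 3), (1, 2), (1, 4), (4, 5), (5, 6)])
      (by decide +kernel)
  · exact Realizes.exists_graph (G := graphOfEdges _
      [(0, 1), (0, 2), (0, 3), (0, 4), (1, 4), (1, 5), (1, 6), (2, 3), (5, 6)])
      (by decide +kernel)
  · exact Realizes.exists_graph (G := graphOfEdges _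
      [(0, 1), (0, 2), (0, 3), (0, 4), (1, 4), (1, 5), (2, 3), (2, 6), (5, 6)])
      (by decide +kernel)
  · exact Realizes.exists_graph (G := graphOfEdges _
      [(0, 1), (0, 2), (0, 3), (1, 2), (1, 4), (1, 5), (4, 5), (4, 6)])
      (by decide +kernel)
  · exact Realizes.exists_graph (G := graphOfEdges _
      [(0, 1), (0, 2), (0, 3), (0, 4), (1, 2), (1, 3), (1, 5), (1, 6), (2, 3), (2, 5), (5, 6)])
      (by decide +kernel)
  · exact Realizes.exists_graph (G := graphOfEdges _
      [(0, 1), (0, 2), (0, 3), (0, 4), (1, 3), (1, 4), (1, 5), (2, 3), (2, 6), (3, 5), (5, 6)])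
      (by decide +kernel)
  · exact Realizes.exists_graph (G := graphOfEdges _
      [(0, 1), (0, 2), (1, 3), (3, 4), (4, 5), (5, 6)])
      (by decide +kernel)
  · exact Realizes.exists_graph (G := graphOfEdges _
      [(0, 1), (0, 2), (0, 3), (0, 4), (1, 2), (1, 3), (1, 5), (2, 3), (2, 6)])
      (by decide +kernel)

theorem perfectDominationNumber_le_of_searchAll {n t k : ℕ} {G : SimpleGraph (Fin n)}
    (ht : t = 2 ∨ 3 ≤ t) (hs : searchAll t k n = true) (hcl : G.IsClawFree)
    (hG : ∀ v, ∃ u, G.Adj v u) (hdom : t ≤ G.dominationNumber) :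
    G.perfectDominationNumber ≤ k := by
  obtain ⟨S, hS, hc⟩ := exists_isPerfectDominatingSet G ht hs hcl hG
    fun S hS => hdom.trans (dominationNumber_le hS)
  exact (perfectDominationNumber_le hS).trans hc

end GraphSearch

open GraphSearch in
theorem mainTheorem9 (h k n : ℕ) (hn4 : 4 ≤ n) (hn7 : n ≤ 7)
    (hh : 2 ≤ h) (hhk : h ≤ k) (hkn : k ≤ n) :
    (∃ G : SimpleGraph (Fin n), G.Connected ∧ G.IsClawFree ∧
        G.dominationNumber = h ∧ G.perfectDominationNumber = k) ↔
      (h + k ≤ n ∨ 3 * h + k + 1 ≤ 2 * n ∨ (h = 2 ∧ k = 6 ∧ n = 6)) := by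
  refine ⟨?_, exists_dominationNumbers_eq hn4 hn7 hh hhk hkn⟩
  rintro ⟨G, hconn, hcl, rfl, rfl⟩
  have : Nontrivial (Fin n) := Fin.nontrivial_iff_two_le.mpr (by omega)
  have hG (v : Fin n) : ∃ u, G.Adj v u := hconn.preconnected.exists_adj_of_nontrivial v
  have hOre := SimpleGraph.two_mul_dominationNumber_le hG
  rw [Fintype.card_fin] at hOre
  interval_cases n
  · have := perfectDominationNumber_le_of_searchAll (.inl rfl) searchAll_four hcl hG hh
    omega
  · have := perfectDominationNumber_le_of_searchAll (.inl rfl) searchAll_five hcl hG hh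
    omega
  -- If `γ = 2`, the inequality `3 * h + k + 1 ≤ 2 * n` covers `k ≤ 5`, and `k = 6` is the
  -- exceptional triple.
  · by_cases h3 : 3 ≤ G.dominationNumber
    · have := perfectDominationNumber_le_of_searchAll (.inr le_rfl) searchAll_six hcl hG h3
      omega
    · omega
  -- If `γ = 2`, the same inequality covers all `k ≤ 7`.
  · by_cases h3 : 3 ≤ G.dominationNumber
    · have := perfectDominationNumber_le_of_searchAll (.inr le_rfl) searchAll_seven hcl hG h3
      omega
    · omega
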